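/- Let $\rho_0,\rho_1,\sigma_0,\sigma_1$ be density matrices on $\mathbb{C}^2$ (positive semidefinite complex $2\times2$ matrices of trace one). For a finite set $U$, a probability distribution $p$ on $U\times\{0,1\}$ and a pair $(\tau_0,\tau_1)$ of density matrices, let the guessing probability be $$P_{\mathrm{guess}}(p,\tau)=\max_{P}\sum_{u\in U}\mathrm{Tr}\Big[\Big(\sum_{x\in\{0,1\}}p(u,x)\,\tau_x\Big)P^u\Big],$$ where the maximum is over all POVMs $(P^u)_{u\in U}$ on $\mathbb{C}^2$ (that is, $P^u\ge0$ and $\sum_uP^u=\mathbb{1}$), and let $H_{\min}(p,\tau)=-\log_2P_{\mathrm{guess}}(p,\tau)$. Write $(\rho_0,\rho_1)\succeq(\sigma_0,\sigma_1)$ if $H_{\min}(p,\rho)\le H_{\min}(p,\sigma)$ for every finite set $U$ and every probability distribution $p$ on $U\times\{0,1\}$. Then $(\rho_0,\rho_1)\succeq(\sigma_0,\sigma_1)$ if and only if there exists a completely positive trace-preserving linear map $\Phi$ from the complex $2\times 2$ matrices to themselves such that $\Phi(\rho_0)=\sigma_0$ and $\Phi(\rho_1)=\sigma_1$. Moreover,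 $(\rho_0,\rho_1)\succeq(\sigma_0,\sigma_1)$ holds if and only if the defining inequality holds for all sets $U$ with exactly two elements and all probability distributions $p$ on $U\times\{0,1\}$. -/

import Mathlib

open scoped ComplexOrder MatrixOrder Matrix.Norms.L2Operator CStarAlgebra

noncomputable section

namespace StatComparison

/-- The density matrices (states) of the quantum system with Hilbert space `ℂⁿ`. -/
def IsDensityMatrix {n : Type} [Fintype n] (ρ : Matrix n n ℂ) : Prop :=
  ρ.PosSemidef ∧ ρ.trace = 1

/-- `P` is a positive-operator valued measure on `ℂⁿ` with outcomes in the finite set `U`. -/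
def IsPOVM {U n : Type} [Fintype U] [Fintype n] [DecidableEq n] (P : U → Matrix n n ℂ) : Prop :=
  (∀ u, (P u).PosSemidef) ∧ ∑ u, P u = 1

/-- The `u`-th block of the classical-quantum state
`∑ u, ∑ x, p (u, x) |u⟩⟨u| ⊗ ρ x`, that is, `p(u) ρ^u` with `p(u) = ∑ x, p (u, x)` and
`ρ^u = ∑ x, p(x|u) ρ x`. -/
def cqBlock {U n : Type} (p : U × Fin 2 → ℝ) (ρ : Fin 2 → Matrix n n ℂ) (u : U) : Matrix n n ℂ :=
  ∑ x, (p (u, x) : ℂ) • ρ x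

/-- The probability `∑ u, p(u) Tr[ρ^u P^u]` of guessing the value of `u` correctly
with the measurement `P`. -/
def successProb {U n : Type} [Fintype U] [Fintype n] (p : U × Fin 2 → ℝ)
    (ρ : Fin 2 → Matrix n n ℂ) (P : U → Matrix n n ℂ) : ℝ :=
  ∑ u, ((cqBlock p ρ u * P u).trace).re

/-- The optimal guessing probability `P_guess(U|Q)_ρ`
(the supremum is attained, see `exists_isPOVM_successProb_eq`). -/
def guessProb {U n : Type} [Fintype U] [Fintype n] [DecidableEq n] (p : U × Fin 2 → ℝ)
    (ρ : Fin 2 → Matrix n n ℂ) : ℝ :=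
  sSup {g : ℝ | ∃ P : U → Matrix n n ℂ, IsPOVM P ∧ g = successProb p ρ P}

/-- The conditional min-entropy `H_min(U|Q)_ρ = -log₂ P_guess(U|Q)_ρ`. -/
def minEntropy {U n : Type} [Fintype U] [Fintype n] [DecidableEq n] (p : U × Fin 2 → ℝ)
    (ρ : Fin 2 → Matrix n n ℂ) : ℝ :=
  -Real.logb 2 (guessProb p ρ)

/-- The comparison of two pairs of states for one fixed finite set `U`:
`H_min(U|Q)_ρ ≤ H_min(U|Q')_σ` for all probability distributions `p` on `U × {0, 1}`. -/
def MoreInformativeOn (U : Type) [Fintype U] {n m : Type} [Fintype n] [DecidableEq n]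
    [Fintype m] [DecidableEq m] (ρ : Fin 2 → Matrix n n ℂ) (σ : Fin 2 → Matrix m m ℂ) : Prop :=
  ∀ p ∈ stdSimplex ℝ (U × Fin 2), minEntropy p ρ ≤ minEntropy p σ

/-- The information ordering `(ρ 0, ρ 1) ⪰ (σ 0, σ 1)`. -/
def MoreInformative {n m : Type} [Fintype n] [DecidableEq n] [Fintype m] [DecidableEq m]
    (ρ : Fin 2 → Matrix n n ℂ) (σ : Fin 2 → Matrix m m ℂ) : Prop :=
  ∀ (U : Type) [Fintype U], MoreInformativeOn U ρ σ

/-- The information ordering with the comparison restricted to sets `U` with two elements. -/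
def MoreInformativeBinary {n m : Type} [Fintype n] [DecidableEq n] [Fintype m] [DecidableEq m]
    (ρ : Fin 2 → Matrix n n ℂ) (σ : Fin 2 → Matrix m m ℂ) : Prop :=
  ∀ (U : Type) [Fintype U], Fintype.card U = 2 → MoreInformativeOn U ρ σ

/-- A completely positive map between matrix algebras is trace preserving. -/
def IsTracePreserving {n m : Type} [Fintype n] [DecidableEq n] [Fintype m] [DecidableEq m]
    (Φ : Matrix n n ℂ →CP Matrix m m ℂ) : Prop :=
  ∀ X : Matrix n n ℂ, (Φ X).trace = X.trace

/-- The set of measurements is compact. -/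
theorem isCompact_isPOVM {U n : Type} [Fintype U] [Fintype n] [DecidableEq n] :
    IsCompact {P : U → Matrix n n ℂ | IsPOVM P} := by
  have hb : IsCompact (Set.pi Set.univ fun _ : U => Metric.closedBall (0 : Matrix n n ℂ) 1) := by
    have : ProperSpace (Matrix n n ℂ) := FiniteDimensional.proper ℂ _
    exact isCompact_univ_pi fun _ => isCompact_closedBall _ _
  refine hb.of_isClosed_subset ?_ ?_
  · have h1 : IsClosed {P : U → Matrix n n ℂ | ∀ u, 0 ≤ P u} := by
      simp only [Set.ofPred_forall]
      exact isClosed_iInter fun u => isClosed_Ici.preimage (continuous_apply u)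
    have h2 : IsClosed {P : U → Matrix n n ℂ | ∑ u, P u = 1} :=
      isClosed_eq (continuous_finsetSum _ fun u _ => continuous_apply u) continuous_const
    have h3 : {P : U → Matrix n n ℂ | IsPOVM P} = {P | ∀ u, 0 ≤ P u} ∩ {P | ∑ u, P u = 1} := by
      ext P
      simp [IsPOVM, Matrix.nonneg_iff_posSemidef]
    rw [h3]
    exact h1.inter h2
  · rintro P ⟨hP, hs⟩ u -
    have h0 : ∀ u, 0 ≤ P u := fun u => (hP u).nonneg
    have h1 : P u ≤ 1 := hs ▸ Finset.single_le_sum (fun v _ => h0 v) (Finset.mem_univ u)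
    simpa using (CStarAlgebra.norm_le_one_iff_of_nonneg (P u) (h0 u)).2 h1

/-- The guessing probability is a maximum: some measurement attains it, none exceeds it. -/
theorem exists_isPOVM_successProb_eq {U n : Type} [Fintype U] [Nonempty U] [Fintype n]
    [DecidableEq n] (p : U × Fin 2 → ℝ) (ρ : Fin 2 → Matrix n n ℂ) :
    ∃ P : U → Matrix n n ℂ, IsPOVM P ∧ successProb p ρ P = guessProb p ρ ∧
      ∀ P' : U → Matrix n n ℂ, IsPOVM P' → successProb p ρ P' ≤ guessProb p ρ := by
  classical
  have hne : {P : U → Matrix n n ℂ | IsPOVM P}.Nonempty := by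
    refine ⟨Pi.single (Classical.arbitrary U) 1, fun u => ?_, by simp⟩
    by_cases h : u = Classical.arbitrary U
    · subst h
      simpa using Matrix.PosSemidef.one
    · simpa [h] using Matrix.PosSemidef.zero
  have hc : Continuous (successProb p ρ : (U → Matrix n n ℂ) → ℝ) := by
    unfold successProb
    fun_prop
  obtain ⟨P, hP, hmax⟩ := isCompact_isPOVM.exists_isMaxOn hne hc.continuousOn
  have hg : IsGreatest {g : ℝ | ∃ P : U → Matrix n n ℂ, IsPOVM P ∧ g = successProb p ρ P}
      (successProb p ρ P) := ⟨⟨P, hP, rfl⟩, by rintro _ ⟨P', hP', rfl⟩; exact hmax hP'⟩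
  have he : guessProb p ρ = successProb p ρ P := hg.csSup_eq
  exact ⟨P, hP, he.symm, fun P' hP' => he ▸ hmax hP'⟩

end StatComparison

end

/-!
A pair of qubit states can be mapped to another pair by a channel as soon as it is at least as
useful in every guessing game with two hypotheses (the Alberti-Uhlmann theorem).

A channel `Φ` with adjoint `Φ†` turns a measurement `P` of `Φ ρ` into the measurement `Φ† P` of
`ρ`, so it cannot raise a guessing probability (`moreInformative_of_isTracePreserving`).

Conversely, guessing probabilities for two hypotheses are, up to scaling and an additive constant,
the numbers `max_{0 ≤ P ≤ 1} Tr ((a ρ₀ + b ρ₁) P)` with `a`, `b` real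
(`exists_effect_le_of_moreInformativeBinary`). Assume that they are never smaller for `ρ` than for
`σ`. This has two consequences for the linear map `L : a ρ₀ + b ρ₁ ↦ a σ₀ + b σ₁`: it is positive
(`EffectLE.posSemidef`), and `det (L H) ≥ det H` whenever `det H ≤ 0`, because then the maximum for
`H` is its largest eigenvalue (`EffectLE.det_re_le`).

If `ρ₀ ≠ ρ₁`, the line through them leaves the Bloch ball in two pure states `E₀`, `E₁`
(`exists_det_eq_zero`), and by linearity it is enough to find a channel with `Φ (E i) = S i`, where
`S i = L (E i)` is a state. Comparing the determinants of `x E₀ - y E₁` and `x S₀ - y S₁` for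
`x, y ≥ 0` gives `Tr (E₀ E₁) ≤ Tr (S₀ S₁) + 2 √(det S₀ det S₁)`, whose right side is the squared
fidelity of the two qubit states `S₀`, `S₁`. By Uhlmann's theorem (`exists_purification`) they have
purifications with the same overlap as the vectors of `E₀`, `E₁`. Equality of Gram matrices gives an
isometry from these vectors to the purifications, and tracing out the environment is the
channel (`exists_channel_of_gram`).
-/

namespace StatComparison

open Matrix

/-! ### Channels given by Kraus operators, and adjoints -/

section

variable {n : Type} [Fintype n] [DecidableEq n]

/-- The completely positive map `X ↦ ∑ k, A k * X * (A k)ᴴ` with Kraus operators `A k`. -/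
noncomputable def krausMap {κ : Type} [Fintype κ] (A : κ → Matrix n n ℂ) :
    Matrix n n ℂ →CP Matrix n n ℂ where
  toFun X := ∑ k, A k * X * (A k)ᴴ
  map_add' X Y := by simp [Matrix.mul_add, Matrix.add_mul, Finset.sum_add_distrib]
  map_smul' c X := by simp [Finset.smul_sum]
  map_cstarMatrix_nonneg' r M hM := by
    let D : κ → CStarMatrix (Fin r) (Fin r) (Matrix n n ℂ) :=
      fun k => CStarMatrix.ofMatrix (Matrix.diagonal fun _ => A k)
    have hk : ∀ k i j, (D k * M * star (D k)) i j = A k * M i j * (A k)ᴴ := by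
      intro k i j
      have hD : ∀ i j, D k i j = if i = j then A k else 0 := fun _ _ => rfl
      simp [CStarMatrix.mul_apply, CStarMatrix.star_apply, hD, apply_ite star,
        Matrix.star_eq_conjTranspose]
    have h : M.map (fun X : Matrix n n ℂ => ∑ k, A k * X * (A k)ᴴ) = ∑ k, D k * M * star (D k) := by
      refine CStarMatrix.ext fun i j => ?_
      have hs : (∑ k, D k * M * star (D k)) i j = ∑ k, (D k * M * star (D k)) i j := by
        induction (Finset.univ : Finset κ) using Finset.cons_induction with
        | empty => rfl
        | cons a s _ ih => rw [Finset.sum_cons, Finset.sum_cons, CStarMatrix.add_apply, ih]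
      rw [hs]
      simp only [hk, CStarMatrix.map_apply]
    change 0 ≤ M.map (fun X : Matrix n n ℂ => ∑ k, A k * X * (A k)ᴴ)
    rw [h]
    exact Finset.sum_nonneg fun k _ => star_right_conjugate_nonneg hM (D k)

theorem krausMap_apply {κ : Type} [Fintype κ] (A : κ → Matrix n n ℂ) (X : Matrix n n ℂ) :
    krausMap A X = ∑ k, A k * X * (A k)ᴴ := rfl

theorem isTracePreserving_krausMap {κ : Type} [Fintype κ] {A : κ → Matrix n n ℂ}
    (hA : ∑ k, (A k)ᴴ * A k = 1) : IsTracePreserving (krausMap A) := by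
  intro X
  calc (krausMap A X).trace = ∑ k, ((A k)ᴴ * A k * X).trace := by
        rw [krausMap_apply, Matrix.trace_sum]
        exact Finset.sum_congr rfl fun k _ => by
          rw [Matrix.trace_mul_comm, Matrix.mul_assoc]
    _ = X.trace := by rw [← Matrix.trace_sum, ← Finset.sum_mul, hA, one_mul]

theorem PosSemidef.trace_mul_nonneg {A B : Matrix n n ℂ} (hA : A.PosSemidef) (hB : B.PosSemidef) :
    0 ≤ (A * B).trace := by
  obtain ⟨C, rfl⟩ := CStarAlgebra.nonneg_iff_eq_star_mul_self.mp hB.nonneg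
  rw [← Matrix.mul_assoc, Matrix.trace_mul_comm, ← Matrix.mul_assoc]
  exact (hA.mul_mul_conjTranspose_same C).trace_nonneg

/-- The adjoint of a map between matrix algebras for the pairing `(A, B) ↦ Tr (A * B)`. -/
def traceAdjoint (Φ : Matrix n n ℂ → Matrix n n ℂ) (Q : Matrix n n ℂ) : Matrix n n ℂ :=
  Matrix.of fun i j => (Φ (Matrix.single j i 1) * Q).trace

theorem trace_mul_traceAdjoint (Φ : Matrix n n ℂ →CP Matrix n n ℂ) (X Q : Matrix n n ℂ) :
    (X * traceAdjoint Φ Q).trace = (Φ X * Q).trace := by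
  conv_rhs => rw [Matrix.matrix_eq_sum_single X]
  have hs : ∀ i j, Matrix.single i j (X i j) = X i j • Matrix.single i j (1 : ℂ) := by
    intro i j; simp
  simp only [hs, map_sum, map_smul, Finset.sum_mul, Matrix.trace_sum, Matrix.smul_mul,
    Matrix.trace_smul]
  simp [Matrix.trace, Matrix.mul_apply, traceAdjoint]

theorem posSemidef_traceAdjoint (Φ : Matrix n n ℂ →CP Matrix n n ℂ) {Q : Matrix n n ℂ}
    (hQ : Q.PosSemidef) : (traceAdjoint Φ Q).PosSemidef := by
  refine Matrix.PosSemidef.of_dotProduct_mulVec_nonneg ?_ fun v => ?_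
  · ext i j
    have h : Φ (Matrix.single i j 1) = (Φ (Matrix.single j i 1))ᴴ := by
      have := map_star Φ (Matrix.single j i (1 : ℂ))
      rw [← Matrix.star_eq_conjTranspose, ← this]
      congr 1
      simp [Matrix.star_eq_conjTranspose]
    simp only [traceAdjoint, Matrix.conjTranspose_apply, Matrix.of_apply]
    rw [h, ← Matrix.trace_conjTranspose, Matrix.conjTranspose_mul, hQ.isHermitian.eq,
      Matrix.conjTranspose_conjTranspose, Matrix.trace_mul_comm]
  · have h1 : star v ⬝ᵥ traceAdjoint Φ Q *ᵥ v =
        (Matrix.vecMulVec v (star v) * traceAdjoint Φ Q).trace := by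
      rw [Matrix.vecMulVec_mul, Matrix.trace_vecMulVec, Matrix.dotProduct_mulVec,
        dotProduct_comm]
    rw [h1, trace_mul_traceAdjoint]
    refine PosSemidef.trace_mul_nonneg ?_ hQ
    exact (map_nonneg Φ (Matrix.posSemidef_vecMulVec_self_star v).nonneg).posSemidef

/-! ### Guessing probabilities -/

theorem guessProb_pos {U : Type} [Fintype U] {p : U × Fin 2 → ℝ}
    (hp : p ∈ stdSimplex ℝ (U × Fin 2)) {ρ : Fin 2 → Matrix n n ℂ}
    (hρ : ∀ x, (ρ x).trace = 1) : 0 < guessProb p ρ := by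
  have hU : Nonempty U := by
    by_contra h
    rw [not_nonempty_iff] at h
    simpa using hp.2
  obtain ⟨-, -, -, hmax⟩ := exists_isPOVM_successProb_eq p ρ
  have hc : (0 : ℝ) < Fintype.card U := by exact_mod_cast Fintype.card_pos
  -- Uniformly random guessing succeeds with probability `1 / card U`.
  let P : U → Matrix n n ℂ := fun _ => ((Fintype.card U : ℝ)⁻¹ : ℂ) • 1
  have hP : IsPOVM P := by
    refine ⟨fun u => Matrix.PosSemidef.one.smul ?_, ?_⟩
    · exact_mod_cast (inv_pos.2 hc).le
    · simp only [P, Finset.sum_const, Finset.card_univ, ← Nat.cast_smul_eq_nsmul ℂ, smul_smul]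
      have : (Fintype.card U : ℂ) ≠ 0 := by exact_mod_cast hc.ne'
      simp [this]
  refine lt_of_lt_of_le ?_ (hmax P hP)
  have hs : successProb p ρ P = (Fintype.card U : ℝ)⁻¹ * ∑ u, ∑ x, p (u, x) := by
    simp only [successProb, cqBlock, P, Matrix.mul_smul, Matrix.trace_smul,
      Matrix.trace_sum, hρ, Finset.mul_sum, smul_eq_mul, Complex.re_sum, mul_one]
    refine Finset.sum_congr rfl fun u _ => Finset.sum_congr rfl fun x _ => ?_
    norm_cast
  rw [hs, ← Fintype.sum_prod_type', hp.2, mul_one]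
  exact inv_pos.2 hc

/-- Data processing: measuring `Φ ρ` with `P` is the same as measuring `ρ` with the images of `P`
under the adjoint of `Φ`. -/
theorem moreInformative_of_isTracePreserving (Φ : Matrix n n ℂ →CP Matrix n n ℂ)
    (hΦ : IsTracePreserving Φ) {ρ σ : Fin 2 → Matrix n n ℂ} (hρ : ∀ x, (ρ x).trace = 1)
    (h : ∀ x, Φ (ρ x) = σ x) : MoreInformative ρ σ := by
  intro U _ p hp
  have hσ : ∀ x, (σ x).trace = 1 := fun x => by rw [← h, hΦ, hρ]
  have hU : Nonempty U := by
    by_contra hU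
    rw [not_nonempty_iff] at hU
    simpa using hp.2
  obtain ⟨P, hP, hPg, -⟩ := exists_isPOVM_successProb_eq p σ
  obtain ⟨-, -, -, hmax⟩ := exists_isPOVM_successProb_eq p ρ
  have hle : guessProb p σ ≤ guessProb p ρ := by
    rw [← hPg]
    have hs : successProb p σ P = successProb p ρ fun u => traceAdjoint Φ (P u) := by
      refine Finset.sum_congr rfl fun u _ => ?_
      have hc : Φ (cqBlock p ρ u) = cqBlock p σ u := by
        simp only [cqBlock, map_sum, map_smul, h]
      rw [trace_mul_traceAdjoint, hc]
    rw [hs]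
    refine hmax _ ⟨fun u => posSemidef_traceAdjoint Φ (hP.1 u), ?_⟩
    ext i j
    rw [Matrix.sum_apply]
    simp only [traceAdjoint, Matrix.of_apply]
    rw [← Matrix.trace_sum, ← Finset.mul_sum, hP.2, Matrix.mul_one, hΦ]
    by_cases hij : i = j
    · subst hij; simp
    · simp [hij, Matrix.trace_single_eq_of_ne _ _ _ (Ne.symm hij)]
  exact neg_le_neg (Real.logb_le_logb_of_le one_lt_two (guessProb_pos hp hσ) hle)

/-- For two hypotheses, comparing guessing probabilities amounts to comparing the best
expectations of real combinations of the two states over effects, that is, over matrices between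
`0` and `1`. -/
theorem exists_effect_le_of_moreInformativeBinary {ρ₀ ρ₁ σ₀ σ₁ : Matrix n n ℂ}
    (hρ₀ : ρ₀.trace = 1) (hρ₁ : ρ₁.trace = 1) (hσ₀ : σ₀.trace = 1) (hσ₁ : σ₁.trace = 1)
    (h : MoreInformativeBinary ![ρ₀, ρ₁] ![σ₀, σ₁]) (a b : ℝ) {Q : Matrix n n ℂ}
    (hQ : Q ∈ Set.Icc 0 1) :
    ∃ P ∈ Set.Icc (0 : Matrix n n ℂ) 1,
      (((a : ℂ) • σ₀ + (b : ℂ) • σ₁) * Q).trace.re ≤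
        (((a : ℂ) • ρ₀ + (b : ℂ) • ρ₁) * P).trace.re := by
  by_cases hab : |a| + |b| = 0
  · have ha : a = 0 := by
      have := abs_nonneg a; have := abs_nonneg b; exact abs_eq_zero.1 (by linarith)
    have hb : b = 0 := by
      have := abs_nonneg a; have := abs_nonneg b; exact abs_eq_zero.1 (by linarith)
    exact ⟨Q, hQ, by simp [ha, hb]⟩
  have hs : 0 < |a| + |b| := lt_of_le_of_ne (by positivity) (Ne.symm hab)
  set s := |a| + |b| with hsdef
  -- Outcome `true` carries the positive parts of the coefficients, `false` the negative parts.
  let p : Bool × Fin 2 → ℝ := fun u =>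
    (if u.1 then ![a⁺, b⁺] u.2 else ![a⁻, b⁻] u.2) / s
  have hp : p ∈ stdSimplex ℝ (Bool × Fin 2) := by
    refine ⟨?_, ?_⟩
    · rintro ⟨u, x⟩
      refine div_nonneg ?_ hs.le
      cases u <;> fin_cases x <;> simp [posPart_nonneg, negPart_nonneg]
    · simp only [p, Fintype.sum_prod_type, Fintype.sum_bool, Fin.sum_univ_two]
      simp only [if_true, Matrix.cons_val_zero, Matrix.cons_val_one, Bool.false_eq_true, if_false]
      rw [← add_div, ← add_div, ← add_div, div_eq_one_iff_eq hs.ne', hsdef,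
        ← posPart_add_negPart a, ← posPart_add_negPart b]
      ring
  have key : ∀ τ₀ τ₁ : Matrix n n ℂ, τ₀.trace = 1 → τ₁.trace = 1 → ∀ P : Bool → Matrix n n ℂ,
      IsPOVM P → s * successProb p ![τ₀, τ₁] P =
        (((a : ℂ) • τ₀ + (b : ℂ) • τ₁) * P true).trace.re + (a⁻ + b⁻) := by
    intro τ₀ τ₁ h₀ h₁ P hP
    have hf : P false = 1 - P true := by
      have := hP.2
      rw [Fintype.sum_bool] at this
      rw [← this]; abel
    have ha : a = a⁺ - a⁻ := (posPart_sub_negPart a).symm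
    have hb : b = b⁺ - b⁻ := (posPart_sub_negPart b).symm
    have hsp : ∀ r : ℝ, s * (r / s) = r := fun r => by field_simp
    simp only [successProb, cqBlock, Fintype.sum_bool, Fin.sum_univ_two, hf, p, if_true,
      Matrix.cons_val_zero, Matrix.cons_val_one, Bool.false_eq_true, if_false,
      Matrix.add_mul, Matrix.smul_mul, Matrix.trace_add, Matrix.trace_smul, smul_eq_mul,
      Matrix.mul_sub, Matrix.mul_one, Matrix.trace_sub, h₀, h₁, Complex.add_re, Complex.re_ofReal_mul,
      Complex.sub_re, Complex.one_re]
    rw [mul_add, mul_add, mul_add, ← mul_assoc, ← mul_assoc, ← mul_assoc, ← mul_assoc]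
    simp only [hsp]
    linear_combination -(τ₀ * P true).trace.re * ha - (τ₁ * P true).trace.re * hb
  have hle : guessProb p ![σ₀, σ₁] ≤ guessProb p ![ρ₀, ρ₁] := by
    have := h Bool rfl p hp
    have hσ : ∀ x, (![σ₀, σ₁] x).trace = 1 := by simp [Fin.forall_fin_two, hσ₀, hσ₁]
    have hρ : ∀ x, (![ρ₀, ρ₁] x).trace = 1 := by simp [Fin.forall_fin_two, hρ₀, hρ₁]
    exact (Real.logb_le_logb one_lt_two (guessProb_pos hp hσ) (guessProb_pos hp hρ)).1
      (neg_le_neg_iff.1 this)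
  obtain ⟨P, hP, hPg, -⟩ := exists_isPOVM_successProb_eq p ![ρ₀, ρ₁]
  obtain ⟨-, -, -, hmax⟩ := exists_isPOVM_successProb_eq p ![σ₀, σ₁]
  let R : Bool → Matrix n n ℂ := fun u => if u then Q else 1 - Q
  have hR : IsPOVM R := by
    refine ⟨fun u => ?_, by simp [R]⟩
    cases u
    · simpa [R, Matrix.le_iff] using hQ.2
    · simpa [R, Matrix.nonneg_iff_posSemidef] using hQ.1
  refine ⟨P true, ⟨(hP.1 true).nonneg, ?_⟩, ?_⟩
  · have h2 := hP.2
    rw [Fintype.sum_bool] at h2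
    rw [Matrix.le_iff, ← h2, add_sub_cancel_left]
    exact hP.1 false
  · have h1 := key σ₀ σ₁ hσ₀ hσ₁ R hR
    have h2 := key ρ₀ ρ₁ hρ₀ hρ₁ P hP
    have h3 := mul_le_mul_of_nonneg_left ((hmax R hR).trans (hle.trans hPg.ge)) hs.le
    rw [h1, h2] at h3
    simpa [R] using h3

end

/-! ### Effects and Hermitian qubit operators -/

/-- Every effect on the smaller matrix is matched by an effect on the larger one:
`max_Q Tr (K * Q) ≤ max_P Tr (H * P)` over `0 ≤ Q, P ≤ 1`. -/
def EffectLE {n : Type} [Fintype n] [DecidableEq n] (K H : Matrix n n ℂ) : Prop :=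
  ∀ Q ∈ Set.Icc (0 : Matrix n n ℂ) 1, ∃ P ∈ Set.Icc (0 : Matrix n n ℂ) 1,
    (K * Q).trace.re ≤ (H * P).trace.re

theorem posSemidef_of_trace_effect_nonneg {n : Type} [Fintype n] [DecidableEq n]
    {H : Matrix n n ℂ} (hH : H.IsHermitian)
    (h : ∀ Q ∈ Set.Icc (0 : Matrix n n ℂ) 1, Q.trace = 1 → 0 ≤ (H * Q).trace.re) :
    H.PosSemidef := by
  refine Matrix.PosSemidef.of_dotProduct_mulVec_nonneg hH fun v => ?_
  by_cases hv : v = 0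
  · simp [hv]
  have hr0 : 0 < star v ⬝ᵥ v := Matrix.dotProduct_star_self_pos_iff.2 hv
  obtain ⟨r, hr, hrv⟩ : ∃ r : ℝ, 0 < r ∧ star v ⬝ᵥ v = r :=
    ⟨_, (Complex.pos_iff.1 hr0).1, Complex.ext rfl (Complex.pos_iff.1 hr0).2.symm⟩
  have hrc : (r : ℂ) ≠ 0 := by exact_mod_cast hr.ne'
  -- the orthogonal projection onto the line spanned by `v`
  let Q : Matrix n n ℂ := ((r⁻¹ : ℝ) : ℂ) • Matrix.vecMulVec v (star v)
  have hQ0 : Q.PosSemidef := (Matrix.posSemidef_vecMulVec_self_star v).smul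
    (by exact_mod_cast (inv_pos.2 hr).le)
  have hQQ : Q * Q = Q := by
    simp only [Q, Matrix.smul_mul, Matrix.mul_smul, Matrix.vecMulVec_mul_vecMulVec, hrv,
      Complex.ofReal_inv]
    rw [Matrix.vecMulVec_smul, smul_smul, smul_smul, mul_assoc, inv_mul_cancel₀ hrc, mul_one]
  have hQ1 : (1 - Q).PosSemidef := by
    have : 1 - Q = (1 - Q)ᴴ * (1 - Q) := by
      rw [Matrix.conjTranspose_sub, Matrix.conjTranspose_one, hQ0.isHermitian.eq, sub_mul, mul_sub,
        mul_sub, hQQ]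
      simp
    rw [this]
    exact Matrix.posSemidef_conjTranspose_mul_self _
  have hQt : Q.trace = 1 := by
    simp only [Q, Matrix.trace_smul, Matrix.trace_vecMulVec]
    rw [dotProduct_comm, hrv]
    simp [hrc]
  have h1 := h Q ⟨hQ0.nonneg, Matrix.le_iff.2 hQ1⟩ hQt
  have h2 : (H * Q).trace = (r⁻¹ : ℝ) * (star v ⬝ᵥ H *ᵥ v) := by
    simp only [Q, Matrix.mul_smul, Matrix.trace_smul, smul_eq_mul, Matrix.mul_vecMulVec,
      Matrix.trace_vecMulVec]
    rw [dotProduct_comm]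
  rw [h2, Complex.re_ofReal_mul] at h1
  exact Complex.nonneg_iff.2 ⟨nonneg_of_mul_nonneg_right h1 (inv_pos.2 hr),
    (hH.im_star_dotProduct_mulVec_self v).symm⟩

/-- No effect has a positive expectation in `-H`, hence none has one in `-K`. -/
theorem EffectLE.posSemidef {n : Type} [Fintype n] [DecidableEq n]
    {K H : Matrix n n ℂ} (hK : K.IsHermitian) (hH : H.PosSemidef) (h : EffectLE (-K) (-H)) :
    K.PosSemidef := by
  refine posSemidef_of_trace_effect_nonneg hK fun Q hQ _ => ?_
  obtain ⟨P, hP, hle⟩ := h Q hQ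
  have := (Complex.nonneg_iff.1 (PosSemidef.trace_mul_nonneg hH
    (Matrix.nonneg_iff_posSemidef.1 hP.1))).1
  simp only [Matrix.neg_mul, Matrix.trace_neg, Complex.neg_re] at hle
  linarith

/-- A Hermitian `2 × 2` matrix in real coordinates. -/
theorem exists_eq_of_isHermitian {H : Matrix (Fin 2) (Fin 2) ℂ} (hH : H.IsHermitian) :
    ∃ a d x y : ℝ, H = !![(a : ℂ), ⟨x, y⟩; ⟨x, -y⟩, (d : ℂ)] := by
  refine ⟨(H 0 0).re, (H 1 1).re, (H 0 1).re, (H 0 1).im, ?_⟩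
  have h00 := hH.apply 0 0
  have h11 := hH.apply 1 1
  have h10 := hH.apply 1 0
  ext i j
  fin_cases i <;> fin_cases j
  · exact (Complex.conj_eq_iff_re.1 h00).symm
  · rfl
  · simp [← h10, Complex.ext_iff]
  · exact (Complex.conj_eq_iff_re.1 h11).symm

/-- If `det H ≤ 0`, then `H` has at most one positive eigenvalue, and no effect has a larger
expectation than the largest eigenvalue. -/
theorem trace_mul_effect_le {H P : Matrix (Fin 2) (Fin 2) ℂ} (hH : H.IsHermitian)
    (hdet : H.det.re ≤ 0) (hP : P ∈ Set.Icc 0 1) :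
    (H * P).trace.re ≤ (H.trace.re + √(H.trace.re ^ 2 - 4 * H.det.re)) / 2 := by
  have hP0 := Matrix.nonneg_iff_posSemidef.1 hP.1
  have hP1 := Matrix.le_iff.1 hP.2
  have hdP := (Complex.nonneg_iff.1 hP0.det_nonneg).1
  have hd1P := (Complex.nonneg_iff.1 hP1.det_nonneg).1
  have hp := (Complex.nonneg_iff.1 (hP0.diag_nonneg (i := 0))).1
  have hq := (Complex.nonneg_iff.1 (hP0.diag_nonneg (i := 1))).1
  have hp1 := (Complex.nonneg_iff.1 (hP1.diag_nonneg (i := 0))).1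
  have hq1 := (Complex.nonneg_iff.1 (hP1.diag_nonneg (i := 1))).1
  obtain ⟨a, d, x, y, rfl⟩ := exists_eq_of_isHermitian hH
  obtain ⟨p, q, u, v, rfl⟩ := exists_eq_of_isHermitian hP0.isHermitian
  simp [Matrix.det_fin_two, Matrix.trace_fin_two] at *
  have hs : (a + d) ^ 2 - 4 * (a * d - (x * x + y * y)) = (a - d) ^ 2 + 4 * (x ^ 2 + y ^ 2) := by
    ring
  rw [hs]
  set s := √((a - d) ^ 2 + 4 * (x ^ 2 + y ^ 2)) with hsd
  have hs2 : s ^ 2 = (a - d) ^ 2 + 4 * (x ^ 2 + y ^ 2) := Real.sq_sqrt (by positivity)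
  have hs0 : 0 ≤ s := Real.sqrt_nonneg _
  have hsτ : |a + d| ≤ s := Real.abs_le_sqrt (by nlinarith)
  obtain ⟨hsl, hsr⟩ := abs_le.1 hsτ
  set w := √((p - q) ^ 2 + 4 * (u ^ 2 + v ^ 2)) with hwd
  have hw2 : w ^ 2 = (p - q) ^ 2 + 4 * (u ^ 2 + v ^ 2) := Real.sq_sqrt (by positivity)
  have hw0 : 0 ≤ w := Real.sqrt_nonneg _
  -- Cauchy-Schwarz for the Bloch vectors
  have hcs : (a - d) * (p - q) + 4 * (x * u + y * v) ≤ s * w := by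
    refine abs_le_of_sq_le_sq' ?_ (by positivity) |>.2
    rw [mul_pow, hs2, hw2]
    nlinarith [sq_nonneg ((a - d) * u - x * (p - q)), sq_nonneg ((a - d) * v - y * (p - q)),
      sq_nonneg (x * v - y * u)]
  have hw1 : w ≤ p + q := abs_le_of_sq_le_sq' (by nlinarith) (by linarith) |>.2
  have hw3 : w ≤ 2 - (p + q) := abs_le_of_sq_le_sq' (by nlinarith) (by linarith) |>.2
  have hmain : (a + d) * (p + q) + s * w ≤ a + d + s := by
    rcases le_total (p + q) 1 with h | h
    · nlinarith [mul_le_mul_of_nonneg_left hw1 hs0, mul_nonneg (sub_nonneg.2 h)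
        (by linarith : 0 ≤ a + d + s)]
    · nlinarith [mul_le_mul_of_nonneg_left hw3 hs0, mul_nonneg (sub_nonneg.2 h)
        (by linarith : 0 ≤ s - (a + d))]
  linarith

/-- Comparing largest eigenvalues compares determinants, since the traces agree. -/
theorem EffectLE.det_re_le {K H : Matrix (Fin 2) (Fin 2) ℂ} (hK : K.IsHermitian)
    (hH : H.IsHermitian) (ht : K.trace = H.trace) (hdet : H.det.re ≤ 0) (h : EffectLE K H) :
    H.det.re ≤ K.det.re := by
  set τ := H.trace.re with hτ
  -- the largest eigenvalue of `H` bounds that of `K`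
  set μ := (τ + √(τ ^ 2 - 4 * H.det.re)) / 2 with hμ
  have hroot : μ ^ 2 - μ * τ + H.det.re = 0 := by
    have := Real.sq_sqrt (by nlinarith [sq_nonneg τ] : 0 ≤ τ ^ 2 - 4 * H.det.re)
    rw [hμ]
    linear_combination this / 4
  have hpsd : ((μ : ℂ) • 1 - K).PosSemidef := by
    refine posSemidef_of_trace_effect_nonneg ?_ fun Q hQ hQt => ?_
    · refine Matrix.IsHermitian.sub ?_ hK
      simp [Matrix.IsHermitian]
    · obtain ⟨P, hP, hle⟩ := h Q hQ
      have := hle.trans (trace_mul_effect_le hH hdet hP)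
      simpa [Matrix.sub_mul, hQt] using this
  have hnn := (Complex.nonneg_iff.1 hpsd.det_nonneg).1
  have hKτ : τ = K.trace.re := by rw [hτ, ht]
  obtain ⟨a, d, x, y, rfl⟩ := exists_eq_of_isHermitian hK
  have hKd : (!![(a : ℂ), ⟨x, y⟩; ⟨x, -y⟩, (d : ℂ)].det).re = a * d - (x * x + y * y) := by
    simp [Matrix.det_fin_two]
  simp [Matrix.det_fin_two, Matrix.trace_fin_two] at hnn hKτ
  rw [hKτ] at hroot
  rw [hKd]
  linarith

theorem exists_two_roots {A B k : ℝ} (hA : 0 ≤ A) (hk : 0 < k) (h1 : 0 ≤ A + B - k) :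
    ∃ t : Fin 2 → ℝ, t 0 ≠ t 1 ∧ ∀ i, A + B * t i - k * t i ^ 2 = 0 := by
  have hD : 0 < B ^ 2 + 4 * k * A := by
    rcases hA.eq_or_lt with h | h
    · have : 0 < B := by linarith
      positivity
    · positivity
  have hs := Real.sq_sqrt hD.le
  have hs0 := Real.sqrt_pos.2 hD
  set s := √(B ^ 2 + 4 * k * A)
  refine ⟨![(B + s) / (2 * k), (B - s) / (2 * k)], ?_, ?_⟩
  · simp only [Matrix.cons_val_zero, Matrix.cons_val_one]
    rw [Ne, div_left_inj' (by positivity)]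
    intro h
    linarith
  · rw [Fin.forall_fin_two]
    constructor <;>
    · simp only [Matrix.cons_val_zero, Matrix.cons_val_one]
      field_simp
      linear_combination -hs

/-- The line through two distinct states leaves the Bloch ball through two pure states. -/
theorem exists_det_eq_zero {ρ₀ ρ₁ : Matrix (Fin 2) (Fin 2) ℂ} (h₀ : IsDensityMatrix ρ₀)
    (h₁ : IsDensityMatrix ρ₁) (hne : ρ₀ ≠ ρ₁) :
    ∃ t : Fin 2 → ℝ, t 0 ≠ t 1 ∧ ∀ i, (ρ₀ + (t i : ℂ) • (ρ₁ - ρ₀)).det = 0 := by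
  have hd0 := (Complex.nonneg_iff.1 h₀.1.det_nonneg).1
  have hd1 := (Complex.nonneg_iff.1 h₁.1.det_nonneg).1
  obtain ⟨h0, t0⟩ := h₀
  obtain ⟨h1, t1⟩ := h₁
  obtain ⟨a, d, x, y, rfl⟩ := exists_eq_of_isHermitian h0.isHermitian
  obtain ⟨a', d', x', y', rfl⟩ := exists_eq_of_isHermitian h1.isHermitian
  have t0' : d = 1 - a := by
    have := congrArg Complex.re t0
    simp [Matrix.trace_fin_two] at this
    linarith
  have t1' : d' = 1 - a' := by
    have := congrArg Complex.re t1
    simp [Matrix.trace_fin_two] at this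
    linarith
  subst t0' t1'
  simp [Matrix.det_fin_two] at hd0 hd1
  have hk : 0 < (a' - a) ^ 2 + (x' - x) ^ 2 + (y' - y) ^ 2 := by
    by_contra hk
    have e1 : a' = a := by nlinarith [sq_nonneg (a' - a), sq_nonneg (x' - x), sq_nonneg (y' - y)]
    have e2 : x' = x := by nlinarith [sq_nonneg (a' - a), sq_nonneg (x' - x), sq_nonneg (y' - y)]
    have e3 : y' = y := by nlinarith [sq_nonneg (a' - a), sq_nonneg (x' - x), sq_nonneg (y' - y)]
    subst e1 e2 e3
    exact hne rfl
  obtain ⟨t, ht, hr⟩ := exists_two_roots (A := a * (1 - a) - (x * x + y * y))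
    (B := (a' - a) * (1 - a) - a * (a' - a) - 2 * (x * (x' - x) + y * (y' - y))) (by linarith) hk
    (by nlinarith)
  refine ⟨t, ht, fun i => ?_⟩
  have hri := hr i
  apply Complex.ext <;> simp [Matrix.det_fin_two]
  · linear_combination hri
  · ring

/-- A qubit state of determinant zero is pure. -/
theorem exists_eq_vecMulVec {E : Matrix (Fin 2) (Fin 2) ℂ} (hE : E.IsHermitian)
    (ht : E.trace = 1) (hd : E.det = 0) : ∃ e : Fin 2 → ℂ, E = Matrix.vecMulVec e (star e) := by
  obtain ⟨a, d, x, y, rfl⟩ := exists_eq_of_isHermitian hE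
  have ht' : a + d = 1 := by
    have := congrArg Complex.re ht
    simpa [Matrix.trace_fin_two] using this
  have hd' : a * d = x ^ 2 + y ^ 2 := by
    have := congrArg Complex.re hd
    simp [Matrix.det_fin_two] at this
    linarith
  have ha : 0 ≤ a := by nlinarith [sq_nonneg x, sq_nonneg y]
  rcases ha.eq_or_lt with ha | ha
  · subst ha
    have hx : x = 0 := by nlinarith [sq_nonneg x, sq_nonneg y]
    have hy : y = 0 := by nlinarith [sq_nonneg x, sq_nonneg y]
    have hd1 : d = 1 := by linarith
    subst hx hy hd1
    refine ⟨![0, 1], ?_⟩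
    ext i j
    fin_cases i <;> fin_cases j <;> simp [Matrix.vecMulVec_apply, Complex.ext_iff]
  · have hs := Real.mul_self_sqrt ha.le
    have hs0 := Real.sqrt_pos.2 ha
    set s := √a
    refine ⟨![(s : ℂ), ⟨x / s, -y / s⟩], ?_⟩
    ext i j
    fin_cases i <;> fin_cases j <;>
      simp [Matrix.vecMulVec_apply, Complex.ext_iff] 
    · exact hs.symm
    · constructor <;> field_simp
    · constructor <;> field_simp
    · constructor
      · field_simp
        rw [← hs] at hd'
        linear_combination hd'
      · ring

/-! ### Channels from purifications -/

/-- A channel between families of pure states given by their Stinespring dilation: if the vectors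
`e i` form a basis and the families `W i` of vectors (the columns of the matrices `W i`) have the
same Gram matrix, then some channel takes the projection on `e i` to `W i * (W i)ᴴ`. -/
theorem exists_channel_of_gram {n κ : Type} [Fintype n] [DecidableEq n] [Fintype κ]
    {e : n → n → ℂ} (he : IsUnit (Matrix.of e).det) {W : n → Matrix n κ ℂ}
    (hW : ∀ i j, star (e i) ⬝ᵥ e j = ((W i)ᴴ * W j).trace) :
    ∃ Φ : Matrix n n ℂ →CP Matrix n n ℂ, IsTracePreserving Φ ∧
      ∀ i, Φ (Matrix.vecMulVec (e i) (star (e i))) = W i * (W i)ᴴ := by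
  let E : Matrix n n ℂ := (Matrix.of e)ᵀ
  have hE : IsUnit E.det := by rwa [Matrix.det_transpose]
  let Y : κ → Matrix n n ℂ := fun k => Matrix.of fun a i => W i a k
  have hY : ∑ k, (Y k)ᴴ * Y k = Eᴴ * E := by
    ext i j
    have := hW i j
    simp only [dotProduct, Matrix.trace, Matrix.diag_apply, Matrix.mul_apply,
      Matrix.conjTranspose_apply, Pi.star_apply] at this
    simpa [Matrix.sum_apply, Matrix.mul_apply, Y, E] using this.symm
  -- `Y k * E⁻¹` maps each `e i` to the `k`-th column of `W i`.
  refine ⟨krausMap fun k => Y k * E⁻¹, isTracePreserving_krausMap ?_, fun i => ?_⟩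
  · calc ∑ k, (Y k * E⁻¹)ᴴ * (Y k * E⁻¹) = (E⁻¹)ᴴ * (∑ k, (Y k)ᴴ * Y k) * E⁻¹ := by
          simp only [Matrix.conjTranspose_mul, Finset.mul_sum, Finset.sum_mul, Matrix.mul_assoc]
      _ = (E * E⁻¹)ᴴ * (E * E⁻¹) := by
          rw [hY, Matrix.conjTranspose_mul]
          simp only [Matrix.mul_assoc]
      _ = 1 := by simp [Matrix.mul_nonsing_inv _ hE]
  · have hcol : ∀ k, (Y k * E⁻¹) *ᵥ e i = fun a => W i a k := by
      intro k
      have h1 : e i = E *ᵥ Pi.single i 1 := by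
        ext a; simp [E]
      rw [h1, Matrix.mulVec_mulVec, Matrix.mul_assoc, Matrix.nonsing_inv_mul _ hE, Matrix.mul_one]
      ext a; simp [Y]
    rw [krausMap_apply]
    have hk : ∀ k, Y k * E⁻¹ * Matrix.vecMulVec (e i) (star (e i)) * (Y k * E⁻¹)ᴴ =
        Matrix.vecMulVec (fun a => W i a k) (star fun a => W i a k) := by
      intro k
      rw [Matrix.mul_vecMulVec, Matrix.vecMulVec_mul, ← hcol k, Matrix.star_mulVec]
    simp only [hk]
    ext a b
    simp [Matrix.sum_apply, Matrix.vecMulVec_apply, Matrix.mul_apply]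

/-- The channel preparing the state `σ = Bᴴ * B`, with Kraus operators `Bᴴ |k⟩⟨l|`. -/
theorem exists_channel_const {n : Type} [Fintype n] [DecidableEq n] {σ : Matrix n n ℂ}
    (hσ : IsDensityMatrix σ) :
    ∃ Φ : Matrix n n ℂ →CP Matrix n n ℂ, IsTracePreserving Φ ∧
      ∀ X, X.trace = 1 → Φ X = σ := by
  obtain ⟨B, hB⟩ := CStarAlgebra.nonneg_iff_eq_star_mul_self.mp hσ.1.nonneg
  rw [Matrix.star_eq_conjTranspose] at hB
  refine ⟨krausMap fun k : n × n => Bᴴ * Matrix.single k.1 k.2 1, isTracePreserving_krausMap ?_,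
    fun X hX => ?_⟩
  · have ht : ∑ k, (B * Bᴴ) k k = 1 := by
      have h2 := hσ.2
      rw [hB, Matrix.trace_mul_comm] at h2
      exact h2
    have hk : ∀ k l : n, (Bᴴ * Matrix.single k l 1)ᴴ * (Bᴴ * Matrix.single k l 1) =
        Matrix.single l l ((B * Bᴴ) k k) := by
      intro k l
      rw [Matrix.conjTranspose_mul, Matrix.conjTranspose_conjTranspose,
        Matrix.conjTranspose_single, Matrix.mul_assoc, ← Matrix.mul_assoc B, ← Matrix.mul_assoc,
        Matrix.single_mul_mul_single]
      simp
    simp only [Fintype.sum_prod_type, hk]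
    rw [Finset.sum_comm]
    ext i j
    simp only [Matrix.sum_apply, Matrix.single_apply, Matrix.one_apply]
    by_cases hij : i = j
    · subst hij
      simp [ht]
    · simp only [hij, if_false]
      refine Finset.sum_eq_zero fun x _ => Finset.sum_eq_zero fun y _ => if_neg ?_
      rintro ⟨rfl, h⟩
      exact hij h
  · have hk : ∀ k l : n, (Bᴴ * Matrix.single k l 1) * X * (Bᴴ * Matrix.single k l 1)ᴴ =
        Bᴴ * Matrix.single k k (X l l) * B := by
      intro k l
      rw [Matrix.conjTranspose_mul, Matrix.conjTranspose_conjTranspose,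
        Matrix.conjTranspose_single, ← Matrix.mul_assoc, Matrix.mul_assoc Bᴴ, Matrix.mul_assoc Bᴴ,
        Matrix.single_mul_mul_single]
      simp
    rw [krausMap_apply]
    simp only [Fintype.sum_prod_type, hk]
    simp only [← Finset.sum_mul, ← Finset.mul_sum]
    have hs : ∑ k : n, ∑ l : n, Matrix.single k k (X l l) = 1 := by
      ext i j
      simp only [Matrix.sum_apply, Matrix.single_apply, Matrix.one_apply]
      by_cases hij : i = j
      · subst hij
        simpa [Matrix.trace] using hX
      · simp only [hij, if_false]
        refine Finset.sum_eq_zero fun x _ => Finset.sum_eq_zero fun y _ => if_neg ?_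
        rintro ⟨rfl, h⟩
        exact hij h
    rw [hs, Matrix.mul_one, hB]

/-- The unitary factor of the polar decomposition of a `2 × 2` matrix with nonnegative determinant:
it is proportional to `Mᴴ + adj M`, and `Tr (M * U)` is the trace norm of `M`. -/
theorem exists_unitary_trace_mul {M : Matrix (Fin 2) (Fin 2) ℂ} {m : ℝ} (hm : 0 ≤ m)
    (hM : M.det = m) :
    ∃ U : Matrix (Fin 2) (Fin 2) ℂ, U * Uᴴ = 1 ∧
      (M * U).trace = √((M * Mᴴ).trace.re + 2 * m) := by
  obtain ⟨T0, hT⟩ := Complex.nonneg_iff.1 (Matrix.posSemidef_self_mul_conjTranspose M).trace_nonneg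
  set T := (M * Mᴴ).trace.re with hTd
  have hTc : (M * Mᴴ).trace = T := Complex.ext rfl (by simpa using hT.symm)
  set F := √(T + 2 * m) with hF
  have hF2 : F * F = T + 2 * m := Real.mul_self_sqrt (by positivity)
  by_cases hF0 : F = 0
  · have hT0 : T = 0 := by rw [hF0] at hF2; linarith
    have hM0 : M = 0 := by
      rw [← Matrix.trace_mul_conjTranspose_self_eq_zero_iff, hTc, hT0, Complex.ofReal_zero]
    exact ⟨1, by simp, by simp [hM0, hF0]⟩
  have hFc : (F : ℂ) ≠ 0 := by exact_mod_cast hF0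
  have hFF : (F : ℂ) * F = T + 2 * m := by exact_mod_cast hF2
  have hdet := hM
  have hdet' := congrArg star hM
  have hTc' := hTc
  rw [Matrix.det_fin_two] at hdet hdet'
  simp [Matrix.trace_fin_two, Matrix.mul_apply, Fin.sum_univ_two] at hTc' hdet'
  refine ⟨(F : ℂ)⁻¹ • (Mᴴ + M.adjugate), ?_, ?_⟩
  · have hN : (Mᴴ + M.adjugate) * (Mᴴ + M.adjugate)ᴴ = ((F : ℂ) * F) • 1 := by
      rw [hFF, Matrix.adjugate_fin_two]
      ext i j
      fin_cases i <;> fin_cases j <;>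
        simp [Matrix.mul_apply, Fin.sum_univ_two]
      · linear_combination hTc' + hdet + hdet'
      · ring
      · ring
      · linear_combination hTc' + hdet + hdet'
    rw [Matrix.conjTranspose_smul, Matrix.smul_mul, Matrix.mul_smul, hN]
    have hF' : star ((F : ℂ)⁻¹) = (F : ℂ)⁻¹ := by simp
    rw [hF', smul_smul, smul_smul]
    field_simp
    exact one_smul ℂ _
  · rw [Matrix.mul_smul, Matrix.trace_smul, Matrix.mul_add, Matrix.trace_add, Matrix.mul_adjugate,
      hTc, hM]
    simp only [Matrix.trace_smul, Matrix.trace_one, Fintype.card_fin, smul_eq_mul]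
    field_simp
    push_cast
    linear_combination -hFF

/-- Uhlmann's theorem for qubits: every number `c` of modulus at most the fidelity of two states is
the overlap of two of their purifications (here matrices `V`, `W` on the qubit and its
environment). -/
theorem exists_purification {S₀ S₁ : Matrix (Fin 2) (Fin 2) ℂ} (h₀ : S₀.PosSemidef)
    (h₁ : S₁.PosSemidef) {c : ℂ}
    (hc : Complex.normSq c ≤ (S₀ * S₁).trace.re + 2 * (√S₀.det.re * √S₁.det.re)) :
    ∃ V W : Matrix (Fin 2) (Fin 2 ⊕ Fin 2) ℂ,
      V * Vᴴ = S₀ ∧ W * Wᴴ = S₁ ∧ (Vᴴ * W).trace = c := by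
  set B₀ := CFC.sqrt S₀ with hB₀
  set B₁ := CFC.sqrt S₁ with hB₁
  have hh₀ : B₀ᴴ = B₀ := (CFC.sqrt_nonneg S₀).posSemidef.isHermitian.eq
  have hh₁ : B₁ᴴ = B₁ := (CFC.sqrt_nonneg S₁).posSemidef.isHermitian.eq
  have hs₀ : B₀ * B₀ = S₀ := CFC.sqrt_mul_sqrt_self S₀ h₀.nonneg
  have hs₁ : B₁ * B₁ = S₁ := CFC.sqrt_mul_sqrt_self S₁ h₁.nonneg
  have hdet : (B₀ * B₁).det = ((√S₀.det.re * √S₁.det.re : ℝ) : ℂ) := by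
    rw [Matrix.det_mul, h₀.det_sqrt, h₁.det_sqrt, RCLike.sqrt_of_nonneg h₀.det_nonneg,
      RCLike.sqrt_of_nonneg h₁.det_nonneg]
    simp
  obtain ⟨U, hU, hUt⟩ := exists_unitary_trace_mul (by positivity) hdet
  have hT : ((B₀ * B₁) * (B₀ * B₁)ᴴ).trace = (S₀ * S₁).trace := by
    rw [Matrix.conjTranspose_mul, hh₀, hh₁, ← hs₀, ← hs₁, Matrix.mul_assoc, Matrix.trace_mul_comm]
    simp only [Matrix.mul_assoc]
    rw [Matrix.trace_mul_comm]
    simp only [Matrix.mul_assoc]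
    rw [Matrix.trace_mul_comm]
    simp only [Matrix.mul_assoc]
  rw [hT] at hUt
  set F := √((S₀ * S₁).trace.re + 2 * (√S₀.det.re * √S₁.det.re)) with hF
  have hcF : ‖c‖ ≤ F := by
    apply Real.le_sqrt_of_sq_le
    rwa [← Complex.normSq_eq_norm_sq]
  -- `s` scales the maximal overlap `F` down to `c`; `r` restores the norm.
  obtain ⟨s, hs, hsF⟩ : ∃ s : ℂ, ‖s‖ ≤ 1 ∧ s * F = c := by
    by_cases hF0 : F = 0
    · refine ⟨0, by simp, ?_⟩
      have : ‖c‖ = 0 := le_antisymm (hF0 ▸ hcF) (norm_nonneg c)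
      simp [norm_eq_zero.1 this]
    · have hFp : 0 < F := lt_of_le_of_ne (Real.sqrt_nonneg _) (Ne.symm hF0)
      have hFc : (F : ℂ) ≠ 0 := by exact_mod_cast hF0
      refine ⟨c / F, ?_, by field_simp⟩
      rw [norm_div, Complex.norm_real, Real.norm_of_nonneg hFp.le]
      exact (div_le_one hFp).2 hcF
  obtain ⟨r, hr⟩ : ∃ r : ℝ, s * star s + (r : ℂ) * r = 1 := by
    refine ⟨√(1 - ‖s‖ ^ 2), ?_⟩
    have h1 : 0 ≤ 1 - ‖s‖ ^ 2 := by nlinarith [norm_nonneg s]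
    have h2 : s * star s = ((‖s‖ ^ 2 : ℝ) : ℂ) := by
      rw [← Complex.normSq_eq_norm_sq]; exact Complex.mul_conj s
    rw [h2, ← Complex.ofReal_mul, Real.mul_self_sqrt h1]
    push_cast
    ring
  refine ⟨Matrix.fromCols B₀ 0, Matrix.fromCols (s • (B₁ * U)) ((r : ℂ) • (B₁ * U)), ?_, ?_, ?_⟩
  · rw [Matrix.conjTranspose_fromCols_eq_fromRows_conjTranspose, Matrix.fromCols_mul_fromRows, hh₀,
      hs₀]
    simp
  · have hBU : (B₁ * U) * (B₁ * U)ᴴ = S₁ := by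
      rw [Matrix.conjTranspose_mul, Matrix.mul_assoc, ← Matrix.mul_assoc U, hU, hh₁,
        Matrix.one_mul, hs₁]
    rw [Matrix.conjTranspose_fromCols_eq_fromRows_conjTranspose, Matrix.fromCols_mul_fromRows,
      Matrix.conjTranspose_smul, Matrix.conjTranspose_smul, Matrix.smul_mul, Matrix.mul_smul,
      Matrix.smul_mul, Matrix.mul_smul, hBU, smul_smul, smul_smul, ← add_smul]
    have : star (r : ℂ) = r := Complex.conj_ofReal r
    rw [this, hr, one_smul]
  · rw [Matrix.trace_mul_comm, Matrix.conjTranspose_fromCols_eq_fromRows_conjTranspose,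
      Matrix.fromCols_mul_fromRows, hh₀, Matrix.conjTranspose_zero, Matrix.mul_zero, add_zero,
      Matrix.smul_mul, Matrix.trace_smul, Matrix.trace_mul_comm, ← Matrix.mul_assoc, hUt,
      smul_eq_mul, hsF]

/-! ### The Alberti-Uhlmann theorem for qubits -/

theorem le_two_mul_sqrt {A B K : ℝ} (hA : 0 ≤ A) (hB : 0 ≤ B)
    (h : ∀ x y : ℝ, 0 ≤ x → 0 ≤ y → 0 ≤ A * x ^ 2 - K * (x * y) + B * y ^ 2) :
    K ≤ 2 * (√A * √B) := by
  rcases le_total K 0 with hK | hK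
  · exact hK.trans (by positivity)
  have hq : ∀ x : ℝ, 0 ≤ A * (x * x) + -K * x + B := by
    intro x
    rcases le_total 0 x with hx | hx
    · have := h x 1 hx zero_le_one
      nlinarith
    · nlinarith [mul_nonneg hK (neg_nonneg.2 hx), mul_nonneg hA (mul_self_nonneg x)]
  have hd := discrim_le_zero hq
  rw [discrim] at hd
  rw [← Real.sqrt_mul hA]
  have h4 : K / 2 ≤ √(A * B) := Real.le_sqrt_of_sq_le (by nlinarith)
  linarith

/-- Lagrange's identity: the squared volume of two unit vectors is the failure of their projections
to overlap. -/
theorem normSq_det_add_trace_mul {e : Fin 2 → Fin 2 → ℂ} {E : Fin 2 → Matrix (Fin 2) (Fin 2) ℂ}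
    (hE : ∀ i, E i = Matrix.vecMulVec (e i) (star (e i))) (ht : ∀ i, (E i).trace = 1) :
    ((Complex.normSq (Matrix.of e).det : ℝ) : ℂ) + (E 0 * E 1).trace = 1 := by
  have h0 := ht 0
  have h1 := ht 1
  rw [hE] at h0 h1
  rw [hE, hE, ← Complex.mul_conj, Matrix.det_fin_two]
  simp [Matrix.trace_fin_two, Matrix.mul_apply, Matrix.vecMulVec_apply, Fin.sum_univ_two]
    at h0 h1 ⊢
  linear_combination (e 1 0 * (starRingEnd ℂ) (e 1 0) + e 1 1 * (starRingEnd ℂ) (e 1 1)) * h0 + h1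

/-- Domination on effects of all real combinations of the two states suffices for a channel:
extend the linear map `ρ₀ ↦ σ₀, ρ₁ ↦ σ₁` to the pure states on the line through `ρ₀` and `ρ₁`,
and realize their images by purifications with the same overlap. -/
theorem exists_channel_of_effectLE {ρ₀ ρ₁ σ₀ σ₁ : Matrix (Fin 2) (Fin 2) ℂ}
    (hρ₀ : IsDensityMatrix ρ₀) (hρ₁ : IsDensityMatrix ρ₁)
    (hσ₀ : IsDensityMatrix σ₀) (hσ₁ : IsDensityMatrix σ₁)
    (h : ∀ a b : ℝ, EffectLE ((a : ℂ) • σ₀ + (b : ℂ) • σ₁) ((a : ℂ) • ρ₀ + (b : ℂ) • ρ₁)) :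
    ∃ Φ : Matrix (Fin 2) (Fin 2) ℂ →CP Matrix (Fin 2) (Fin 2) ℂ,
      IsTracePreserving Φ ∧ Φ ρ₀ = σ₀ ∧ Φ ρ₁ = σ₁ := by
  have hherm : ∀ {τ₀ τ₁ : Matrix (Fin 2) (Fin 2) ℂ}, IsDensityMatrix τ₀ → IsDensityMatrix τ₁ →
      ∀ a b : ℝ, ((a : ℂ) • τ₀ + (b : ℂ) • τ₁).IsHermitian := by
    intro τ₀ τ₁ h₀ h₁ a b
    rw [Matrix.IsHermitian, Matrix.conjTranspose_add, Matrix.conjTranspose_smul,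
      Matrix.conjTranspose_smul, h₀.1.isHermitian.eq, h₁.1.isHermitian.eq]
    simp
  have htr : ∀ {τ₀ τ₁ : Matrix (Fin 2) (Fin 2) ℂ}, IsDensityMatrix τ₀ → IsDensityMatrix τ₁ →
      ∀ a b : ℝ, ((a : ℂ) • τ₀ + (b : ℂ) • τ₁).trace = a + b := by
    intro τ₀ τ₁ h₀ h₁ a b
    simp [h₀.2, h₁.2]
  -- The linear map `a ρ₀ + b ρ₁ ↦ a σ₀ + b σ₁` is positive.
  have hpos : ∀ a b : ℝ, ((a : ℂ) • ρ₀ + (b : ℂ) • ρ₁).PosSemidef →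
      ((a : ℂ) • σ₀ + (b : ℂ) • σ₁).PosSemidef := by
    intro a b hab
    refine EffectLE.posSemidef (hherm hσ₀ hσ₁ a b) hab ?_
    have := h (-a) (-b)
    simpa only [Complex.ofReal_neg, neg_smul, ← neg_add] using this
  by_cases hne : ρ₀ = ρ₁
  · subst hne
    have hσ : σ₀ = σ₁ := by
      have h1 := hpos 1 (-1) (by simpa using Matrix.PosSemidef.zero)
      have h2 := hpos (-1) 1 (by simpa using Matrix.PosSemidef.zero)
      refine le_antisymm (Matrix.le_iff.2 ?_) (Matrix.le_iff.2 ?_)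
      · simpa [neg_add_eq_sub] using h2
      · simpa [← sub_eq_add_neg] using h1
    obtain ⟨Φ, hΦ, hc⟩ := exists_channel_const hσ₀
    exact ⟨Φ, hΦ, hc _ hρ₀.2, hσ ▸ hc _ hρ₀.2⟩
  obtain ⟨t, ht, hdet⟩ := exists_det_eq_zero hρ₀ hρ₁ hne
  have hcomb : ∀ (τ₀ τ₁ : Matrix (Fin 2) (Fin 2) ℂ) (s : ℝ),
      τ₀ + (s : ℂ) • (τ₁ - τ₀) = ((1 - s : ℝ) : ℂ) • τ₀ + (s : ℂ) • τ₁ := by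
    intro τ₀ τ₁ s
    push_cast
    module
  let E : Fin 2 → Matrix (Fin 2) (Fin 2) ℂ := fun i => ρ₀ + (t i : ℂ) • (ρ₁ - ρ₀)
  let S : Fin 2 → Matrix (Fin 2) (Fin 2) ℂ := fun i => σ₀ + (t i : ℂ) • (σ₁ - σ₀)
  have hEh : ∀ i, (E i).IsHermitian := fun i => by
    simp only [E]; rw [hcomb]; exact hherm hρ₀ hρ₁ _ _
  have hEt : ∀ i, (E i).trace = 1 := fun i => by simp [E, hρ₀.2, hρ₁.2]
  have hSt : ∀ i, (S i).trace = 1 := fun i => by simp [S, hσ₀.2, hσ₁.2]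
  choose e he using fun i => exists_eq_vecMulVec (hEh i) (hEt i) (hdet i)
  have hS : ∀ i, (S i).PosSemidef := by
    intro i
    simp only [S]
    rw [hcomb]
    apply hpos
    rw [← hcomb]
    change (E i).PosSemidef
    rw [he i]
    exact Matrix.posSemidef_vecMulVec_self_star _
  have hlag := normSq_det_add_trace_mul he hEt
  have hE10 : E 1 - E 0 = ((t 1 - t 0 : ℝ) : ℂ) • (ρ₁ - ρ₀) := by
    simp only [E]; push_cast; module
  have hS10 : S 1 - S 0 = ((t 1 - t 0 : ℝ) : ℂ) • (σ₁ - σ₀) := by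
    simp only [S]; push_cast; module
  have ht' : ((t 1 - t 0 : ℝ) : ℂ) ≠ 0 := by
    exact_mod_cast sub_ne_zero.2 ht.symm
  have hunit : IsUnit (Matrix.of e).det := by
    rw [isUnit_iff_ne_zero]
    intro h0
    rw [h0, map_zero, Complex.ofReal_zero, zero_add] at hlag
    have hsq : ∀ i, (E i * E i).trace = 1 := by
      intro i
      have hi := hEt i
      rw [he i, Matrix.trace_vecMulVec] at hi
      rw [he i, Matrix.vecMulVec_mul_vecMulVec, dotProduct_comm, hi, one_smul,
        Matrix.trace_vecMulVec, hi]
    have hz : E 1 - E 0 = 0 := by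
      rw [← Matrix.trace_conjTranspose_mul_self_eq_zero_iff, Matrix.conjTranspose_sub, (hEh 1).eq,
        (hEh 0).eq, sub_mul, mul_sub, mul_sub, Matrix.trace_sub, Matrix.trace_sub,
        Matrix.trace_sub, hsq, hsq, Matrix.trace_mul_comm (E 1) (E 0), hlag]
      ring
    rw [hE10] at hz
    exact hne (sub_eq_zero.1 ((smul_eq_zero.1 hz).resolve_left ht')).symm
  -- The overlap of the pure states does not exceed the fidelity of their images.
  have hfid : Complex.normSq (star (e 0) ⬝ᵥ e 1) ≤
      (S 0 * S 1).trace.re + 2 * (√(S 0).det.re * √(S 1).det.re) := by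
    have hov : Complex.normSq (star (e 0) ⬝ᵥ e 1) = (E 0 * E 1).trace.re := by
      have : (E 0 * E 1).trace = ((Complex.normSq (star (e 0) ⬝ᵥ e 1) : ℝ) : ℂ) := by
        rw [he 0, he 1, Matrix.vecMulVec_mul_vecMulVec, Matrix.vecMulVec_smul, Matrix.trace_smul,
          Matrix.trace_vecMulVec, ← Complex.mul_conj, smul_eq_mul]
        congr 1
        change _ = star _
        rw [Matrix.star_dotProduct (e 0), star_star, dotProduct_comm]
      rw [this, Complex.ofReal_re]
    have hov1 : (E 0 * E 1).trace.re ≤ 1 := by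
      have := congrArg Complex.re hlag
      rw [Complex.add_re, Complex.ofReal_re, Complex.one_re] at this
      linarith [Complex.normSq_nonneg (Matrix.of e).det]
    have hdetsub : ∀ (A B : Matrix (Fin 2) (Fin 2) ℂ), A.trace = 1 → B.trace = 1 → ∀ x y : ℝ,
        ((x : ℂ) • A - (y : ℂ) • B).det.re =
          A.det.re * x ^ 2 - (1 - (A * B).trace.re) * (x * y) + B.det.re * y ^ 2 := by
      intro A B hA hB x y
      have : ((x : ℂ) • A - (y : ℂ) • B).det =
          ((x ^ 2 : ℝ) : ℂ) * A.det - ((x * y : ℝ) : ℂ) * (A.trace * B.trace - (A * B).trace) +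
            ((y ^ 2 : ℝ) : ℂ) * B.det := by
        simp [Matrix.det_fin_two, Matrix.trace_fin_two, Matrix.mul_apply, Fin.sum_univ_two]
        ring
      rw [this, hA, hB, Complex.add_re, Complex.sub_re, Complex.re_ofReal_mul,
        Complex.re_ofReal_mul, Complex.re_ofReal_mul, Complex.sub_re]
      simp
      ring
    rw [hov]
    suffices (E 0 * E 1).trace.re - (S 0 * S 1).trace.re ≤
        2 * (√(S 0).det.re * √(S 1).det.re) by linarith
    refine le_two_mul_sqrt (Complex.nonneg_iff.1 (hS 0).det_nonneg).1
      (Complex.nonneg_iff.1 (hS 1).det_nonneg).1 fun x y hx hy => ?_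
    have hform : ∀ τ₀ τ₁ : Matrix (Fin 2) (Fin 2) ℂ,
        (x : ℂ) • (τ₀ + (t 0 : ℂ) • (τ₁ - τ₀)) - (y : ℂ) • (τ₀ + (t 1 : ℂ) • (τ₁ - τ₀)) =
          ((x * (1 - t 0) - y * (1 - t 1) : ℝ) : ℂ) • τ₀ + ((x * t 0 - y * t 1 : ℝ) : ℂ) • τ₁ := by
      intro τ₀ τ₁
      push_cast
      module
    have hEd : ∀ i, (E i).det = 0 := hdet
    have hdE := hdetsub (E 0) (E 1) (hEt 0) (hEt 1) x y
    have hdS := hdetsub (S 0) (S 1) (hSt 0) (hSt 1) x y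
    rw [hEd, hEd, Complex.zero_re] at hdE
    have hxy := mul_nonneg hx hy
    have hle : ((x : ℂ) • E 0 - (y : ℂ) • E 1).det.re ≤ ((x : ℂ) • S 0 - (y : ℂ) • S 1).det.re := by
      have hneg : ((x : ℂ) • E 0 - (y : ℂ) • E 1).det.re ≤ 0 := by
        rw [hdE]
        nlinarith
      simp only [E, S] at hneg ⊢
      rw [hform] at hneg ⊢
      rw [hform]
      refine EffectLE.det_re_le (hherm hσ₀ hσ₁ _ _) (hherm hρ₀ hρ₁ _ _) ?_ hneg (h _ _)
      rw [htr hσ₀ hσ₁, htr hρ₀ hρ₁]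
    rw [hdE, hdS] at hle
    linarith
  obtain ⟨V, W, hV, hW, hVW⟩ := exists_purification (hS 0) (hS 1) hfid
  have hnorm : ∀ i, star (e i) ⬝ᵥ e i = 1 := by
    intro i
    have hi := hEt i
    rwa [he i, Matrix.trace_vecMulVec, dotProduct_comm] at hi
  obtain ⟨Φ, hΦ, hΦe⟩ := exists_channel_of_gram hunit (W := ![V, W]) (by
    rw [Fin.forall_fin_two]
    constructor <;> rw [Fin.forall_fin_two] <;> constructor <;>
      simp only [Matrix.cons_val_zero, Matrix.cons_val_one]
    · rw [hnorm, Matrix.trace_mul_comm, hV, hSt]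
    · exact hVW.symm
    · rw [← Matrix.conjTranspose_conjTranspose V, ← Matrix.conjTranspose_mul,
        Matrix.trace_conjTranspose, hVW, Matrix.star_dotProduct]
    · rw [hnorm, Matrix.trace_mul_comm, hW, hSt])
  have hES : ∀ i, Φ (E i) = S i := by
    intro i
    rw [he i, hΦe]
    fin_cases i
    · exact hV
    · exact hW
  have hdiff : Φ (ρ₁ - ρ₀) = σ₁ - σ₀ := by
    have h1 : Φ (E 1 - E 0) = S 1 - S 0 := by rw [map_sub, hES, hES]
    rw [hE10, hS10, map_smul] at h1
    exact smul_right_injective _ ht' h1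
  have h0 : Φ ρ₀ = σ₀ := by
    have h1 := hES 0
    simp only [E, S] at h1
    rw [map_add, map_smul, hdiff] at h1
    exact add_right_cancel h1
  refine ⟨Φ, hΦ, h0, ?_⟩
  rw [map_sub, h0] at hdiff
  exact sub_left_injective hdiff

end StatComparison

theorem lemma1 (ρ₀ ρ₁ σ₀ σ₁ : Matrix (Fin 2) (Fin 2) ℂ)
    (hρ₀ : StatComparison.IsDensityMatrix ρ₀) (hρ₁ : StatComparison.IsDensityMatrix ρ₁)
    (hσ₀ : StatComparison.IsDensityMatrix σ₀) (hσ₁ : StatComparison.IsDensityMatrix σ₁) :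
    (StatComparison.MoreInformative ![ρ₀, ρ₁] ![σ₀, σ₁] ↔
      ∃ Φ : Matrix (Fin 2) (Fin 2) ℂ →CP Matrix (Fin 2) (Fin 2) ℂ,
        StatComparison.IsTracePreserving Φ ∧ Φ ρ₀ = σ₀ ∧ Φ ρ₁ = σ₁) ∧
    (StatComparison.MoreInformative ![ρ₀, ρ₁] ![σ₀, σ₁] ↔
      StatComparison.MoreInformativeBinary ![ρ₀, ρ₁] ![σ₀, σ₁]) := by
  have hbin : StatComparison.MoreInformative ![ρ₀, ρ₁] ![σ₀, σ₁] →
      StatComparison.MoreInformativeBinary ![ρ₀, ρ₁] ![σ₀, σ₁] := fun h U _ _ => h U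
  have hchan : StatComparison.MoreInformativeBinary ![ρ₀, ρ₁] ![σ₀, σ₁] →
      ∃ Φ : Matrix (Fin 2) (Fin 2) ℂ →CP Matrix (Fin 2) (Fin 2) ℂ,
        StatComparison.IsTracePreserving Φ ∧ Φ ρ₀ = σ₀ ∧ Φ ρ₁ = σ₁ := fun h =>
    StatComparison.exists_channel_of_effectLE hρ₀ hρ₁ hσ₀ hσ₁ fun a b _ hQ =>
      StatComparison.exists_effect_le_of_moreInformativeBinary hρ₀.2 hρ₁.2 hσ₀.2 hσ₁.2 h a b hQ
  have hinf : (∃ Φ : Matrix (Fin 2) (Fin 2) ℂ →CP Matrix (Fin 2) (Fin 2) ℂ,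
        StatComparison.IsTracePreserving Φ ∧ Φ ρ₀ = σ₀ ∧ Φ ρ₁ = σ₁) →
      StatComparison.MoreInformative ![ρ₀, ρ₁] ![σ₀, σ₁] := by
    rintro ⟨Φ, hΦ, h₀, h₁⟩
    exact StatComparison.moreInformative_of_isTracePreserving Φ hΦ
      (by simp [Fin.forall_fin_two, hρ₀.2, hρ₁.2]) (by simp [Fin.forall_fin_two, h₀, h₁])
  exact ⟨⟨fun h => hchan (hbin h), hinf⟩, ⟨hbin, fun h => hinf (hchan h)⟩⟩
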